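/- Let $B_1\subset\mathbb R^2$ be the open unit disc centred at the origin. There exists a Lipschitz function $u:B_1\to\mathbb R$ that is subharmonic in the sense of distributions (that is, $\int_{B_1}u\,\Delta\varphi\,dx\ge 0$ for every $\varphi\in C_c^\infty(B_1)$ with $\varphi\ge 0$) and belongs to the Sobolev space $W^{2,1}(B_1)$, such that for $i=1,2$, for every $q>1$ and for every non-empty open set $\Omega'\subset B_1$, \[ (\partial_{ii}u)_-\notin L^q(\Omega'), \] where $\partial_{ii}u\in L^1(B_1)$ is the weak second derivative of $u$ and $f_-:=\max(-f,0)$ denotes the negative part of $f$. -/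

import Mathlib

open MeasureTheory

noncomputable section

/-- The classical partial derivative `∂_i φ` on `ℝⁿ`. -/
def partialDeriv {n : ℕ} (i : Fin n) (φ : EuclideanSpace ℝ (Fin n) → ℝ) :
    EuclideanSpace ℝ (Fin n) → ℝ :=
  fun x => fderiv ℝ φ x (EuclideanSpace.single i 1)

/-- The iterated classical partial derivative `∂_{i₁} ∂_{i₂} ⋯ ∂_{iₘ} φ`, where `l = [i₁, …, iₘ]`
(and `φ` itself if `l` is empty). -/
def iterPartialDeriv {n : ℕ} (l : List (Fin n)) (φ : EuclideanSpace ℝ (Fin n) → ℝ) :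
    EuclideanSpace ℝ (Fin n) → ℝ :=
  l.foldr partialDeriv φ

/-- `φ ∈ C_c^∞(Ω)`. -/
structure IsTestFunction {n : ℕ} (Ω : Set (EuclideanSpace ℝ (Fin n)))
    (φ : EuclideanSpace ℝ (Fin n) → ℝ) : Prop where
  smooth : ContDiff ℝ (⊤ : ℕ∞) φ
  hasCompactSupport : HasCompactSupport φ
  tsupport_subset : tsupport φ ⊆ Ω

/-- `g ∈ L¹_loc(Ω)` is the weak derivative `∂_{i₁} ⋯ ∂_{iₘ} u` on the open set `Ω` of
`u ∈ L¹_loc(Ω)`, where `l = [i₁, …, iₘ]`. -/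
structure HasWeakDeriv {n : ℕ} (Ω : Set (EuclideanSpace ℝ (Fin n))) (l : List (Fin n))
    (u g : EuclideanSpace ℝ (Fin n) → ℝ) : Prop where
  locallyIntegrableOn_left : LocallyIntegrableOn u Ω
  locallyIntegrableOn_right : LocallyIntegrableOn g Ω
  integral_eq : ∀ φ : EuclideanSpace ℝ (Fin n) → ℝ, IsTestFunction Ω φ →
    ∫ x in Ω, u x * iterPartialDeriv l φ x = (-1) ^ l.length * ∫ x in Ω, g x * φ x

/-- `u ∈ W^{k,p}(Ω)`: all weak derivatives of `u` of order at most `k` (including `u` itself, of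
order `0`) exist and lie in `L^p(Ω)`. -/
def MemSobolevSpace {n : ℕ} (k : ℕ) (p : ENNReal) (Ω : Set (EuclideanSpace ℝ (Fin n)))
    (u : EuclideanSpace ℝ (Fin n) → ℝ) : Prop :=
  MemLp u p (volume.restrict Ω) ∧
    ∀ l : List (Fin n), l.length ≤ k →
      ∃ g : EuclideanSpace ℝ (Fin n) → ℝ, HasWeakDeriv Ω l u g ∧ MemLp g p (volume.restrict Ω)

/-- `u ∈ L¹_loc(Ω)` is subharmonic in the distributional sense: `Δ u ≥ 0` in `𝓓'(Ω)`. -/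
structure IsDistribSubharmonicOn {n : ℕ} (Ω : Set (EuclideanSpace ℝ (Fin n)))
    (u : EuclideanSpace ℝ (Fin n) → ℝ) : Prop where
  locallyIntegrableOn : LocallyIntegrableOn u Ω
  integral_nonneg : ∀ φ : EuclideanSpace ℝ (Fin n) → ℝ, IsTestFunction Ω φ → (∀ x, 0 ≤ φ x) →
    0 ≤ ∫ x in Ω, u x * Laplacian.laplacian φ x

end

open MeasureTheory

noncomputable section

/-! The function is `u = ∑ a_k v_k` with smooth subharmonic building blocks `v_k` (`ripple`). With
`r` the wavelength, `t = (x_j - c) / r` and `Φ'' = 1 / (1 + t²)`, a block is `r (3 Φ(t) + cos(x_i /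
r) / (1 + t²))` up to a constant. The convex term `3 Φ` outweighs the oscillation in the Laplacian.
Gradients are bounded, and second derivatives are at most `(5 / r) / (1 + t²)`, whose integral in
`x_j` does not depend on `r`. Hence the blocks are bounded in Lipschitz seminorm and in `W^{2,1}`
uniformly in `r` and `c`, and `∑ a_k < ∞` gives all the positive statements about `u`.

On the other hand `∂_ii v_k = -cos(x_i / r) / (r (1 + t²))` has negative part of mass of order `d`
on a strip of length `2d` and width `2r` about the line `x_j = c`. With `a_k = 2^(-k²)` and `r_k =
2^(-k⁴)` this mass, of order `a_k d`, survives in `u`. Later terms have total mass `O(2^(-k) a_k)`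
because the `a_m` decay fast. Earlier terms are bounded by `5 a_l / r_l`, which is negligible on a
strip of area `4 d r_k` (`le_neg_of_hasSum`, `le_setIntegral_strip_tsum`). If the negative part were
in `L^q`, Hölder would bound the mass by a constant times `r_k^(1 - 1/q)`, which is `O(2^(-k) a_k)`
for every `q > 1` once `k` is large: a contradiction. Every direction and every rational `c` is used
for infinitely many `k`, so such strips occur in every open set. -/

/-! ### Smooth functions, test functions and integration by parts -/

theorem partialDeriv_contDiff {n : ℕ} {f : EuclideanSpace ℝ (Fin n) → ℝ}
    (hf : ContDiff ℝ (⊤ : ℕ∞) f) (i : Fin n) : ContDiff ℝ (⊤ : ℕ∞) (partialDeriv i f) := by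
  have h : ContDiff ℝ (⊤ : ℕ∞) (fderiv ℝ f) := hf.fderiv_right (by simp)
  exact h.clm_apply contDiff_const

theorem iterPartialDeriv_contDiff {n : ℕ} {f : EuclideanSpace ℝ (Fin n) → ℝ}
    (hf : ContDiff ℝ (⊤ : ℕ∞) f) (l : List (Fin n)) :
    ContDiff ℝ (⊤ : ℕ∞) (iterPartialDeriv l f) := by
  induction l with
  | nil => exact hf
  | cons i l ih => exact partialDeriv_contDiff ih i

theorem IsTestFunction.partialDeriv {n : ℕ} {Ω : Set (EuclideanSpace ℝ (Fin n))}
    {φ : EuclideanSpace ℝ (Fin n) → ℝ} (hφ : IsTestFunction Ω φ) (i : Fin n) :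
    IsTestFunction Ω (partialDeriv i φ) where
  smooth := partialDeriv_contDiff hφ.smooth i
  hasCompactSupport := hφ.hasCompactSupport.fderiv_apply ℝ _
  tsupport_subset := (tsupport_fderiv_apply_subset ℝ _).trans hφ.tsupport_subset

theorem IsTestFunction.iterPartialDeriv {n : ℕ} {Ω : Set (EuclideanSpace ℝ (Fin n))}
    {φ : EuclideanSpace ℝ (Fin n) → ℝ} (hφ : IsTestFunction Ω φ) (l : List (Fin n)) :
    IsTestFunction Ω (iterPartialDeriv l φ) := by
  induction l with
  | nil => exact hφ
  | cons i l ih => exact ih.partialDeriv i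

theorem IsTestFunction.setIntegral_mul {n : ℕ} {Ω : Set (EuclideanSpace ℝ (Fin n))}
    {φ : EuclideanSpace ℝ (Fin n) → ℝ} (hφ : IsTestFunction Ω φ)
    (f : EuclideanSpace ℝ (Fin n) → ℝ) :
    ∫ x in Ω, f x * φ x = ∫ x, f x * φ x := by
  refine setIntegral_eq_integral_of_forall_compl_eq_zero fun x hx => ?_
  rw [image_eq_zero_of_notMem_tsupport fun h => hx (hφ.tsupport_subset h), mul_zero]

theorem integral_mul_partialDeriv {n : ℕ} {f φ : EuclideanSpace ℝ (Fin n) → ℝ}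
    (hf : ContDiff ℝ (⊤ : ℕ∞) f) (hφ : ContDiff ℝ (⊤ : ℕ∞) φ) (hc : HasCompactSupport φ)
    (i : Fin n) :
    ∫ x, f x * partialDeriv i φ x = -∫ x, partialDeriv i f x * φ x := by
  have hf' := partialDeriv_contDiff hf i
  have hφ' := partialDeriv_contDiff hφ i
  refine integral_mul_fderiv_eq_neg_fderiv_mul_of_integrable ?_ ?_ ?_
    (fun x _ => hf.differentiable (by simp) x) (fun x _ => hφ.differentiable (by simp) x)
  · exact (hf'.continuous.mul hφ.continuous).integrable_of_hasCompactSupport hc.mul_left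
  · exact (hf.continuous.mul hφ'.continuous).integrable_of_hasCompactSupport
      (hc.fderiv_apply ℝ _).mul_left
  · exact (hf.continuous.mul hφ.continuous).integrable_of_hasCompactSupport hc.mul_left

theorem iterPartialDeriv_append {n : ℕ} (l m : List (Fin n)) (f : EuclideanSpace ℝ (Fin n) → ℝ) :
    iterPartialDeriv (l ++ m) f = iterPartialDeriv l (iterPartialDeriv m f) := by
  simp [iterPartialDeriv, List.foldr_append]

/-- Integration by parts strips the outermost derivative off `φ` and puts it innermost on `f`.
Recording the reversal avoids any appeal to the symmetry of second derivatives. -/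
theorem integral_mul_iterPartialDeriv {n : ℕ} {φ : EuclideanSpace ℝ (Fin n) → ℝ}
    {Ω : Set (EuclideanSpace ℝ (Fin n))} (hφ : IsTestFunction Ω φ) (l : List (Fin n))
    {f : EuclideanSpace ℝ (Fin n) → ℝ} (hf : ContDiff ℝ (⊤ : ℕ∞) f) :
    ∫ x in Ω, f x * iterPartialDeriv l φ x =
      (-1) ^ l.length * ∫ x in Ω, iterPartialDeriv l.reverse f x * φ x := by
  rw [(hφ.iterPartialDeriv l).setIntegral_mul, hφ.setIntegral_mul]
  induction l generalizing f with
  | nil => simp [iterPartialDeriv]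
  | cons i l ih =>
    have := hφ.iterPartialDeriv l
    rw [List.reverse_cons, iterPartialDeriv_append]
    change ∫ x, f x * partialDeriv i (iterPartialDeriv l φ) x = _
    rw [integral_mul_partialDeriv hf this.smooth this.hasCompactSupport,
      ih (partialDeriv_contDiff hf i)]
    simp [pow_succ, iterPartialDeriv]

/-! ### Series of functions: weak derivatives and subharmonicity -/

/-- By Tonelli `∑ ‖f k x‖` has finite integral, so the series converges almost everywhere; the
default value `0` of `tsum` matters only on a null set. -/
theorem integrable_tsum_of_summable_integral_norm {α : Type*} [MeasurableSpace α] {μ : Measure α}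
    {f : ℕ → α → ℝ} (hf : ∀ k, Integrable (f k) μ) (hs : Summable fun k => ∫ x, ‖f k x‖ ∂μ) :
    Integrable (fun x => ∑' k, f k x) μ := by
  have hfin : ∫⁻ x, ∑' k, ‖f k x‖ₑ ∂μ < ⊤ := by
    rw [lintegral_tsum fun k => (hf k).aestronglyMeasurable.enorm]
    simp_rw [← ofReal_integral_norm_eq_lintegral_enorm (hf _)]
    rw [← ENNReal.ofReal_tsum_of_nonneg (fun k => integral_nonneg fun x => norm_nonneg _) hs]
    exact ENNReal.ofReal_lt_top
  have hae : ∀ᵐ x ∂μ, Summable fun k => f k x := by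
    filter_upwards [ae_lt_top' (AEMeasurable.tsum
      fun k => (hf k).aestronglyMeasurable.enorm) hfin.ne] with x hx
    refine Summable.of_norm ?_
    have := ENNReal.summable_toReal hx.ne
    simpa using this
  refine ⟨?_, ?_⟩
  · refine aestronglyMeasurable_of_tendsto_ae (u := Filter.atTop)
      (f := fun (n : ℕ) x => ∑ k ∈ Finset.range n, f k x) (fun n => ?_) ?_
    · exact Finset.aestronglyMeasurable_fun_sum _ fun k _ => (hf k).aestronglyMeasurable
    · filter_upwards [hae] with x hx using hx.hasSum.tendsto_sum_nat
  · refine lt_of_le_of_lt (lintegral_mono fun x => ?_) hfin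
    exact enorm_tsum_le_tsum_enorm

theorem hasSum_integral_mul_of_bounded {α : Type*} [MeasurableSpace α] {μ : Measure α}
    {f : ℕ → α → ℝ} {g : α → ℝ} {C : ℝ} (hf : ∀ k, Integrable (f k) μ)
    (hs : Summable fun k => ∫ x, ‖f k x‖ ∂μ) (hg : AEStronglyMeasurable g μ)
    (hC : ∀ x, ‖g x‖ ≤ C) :
    HasSum (fun k => ∫ x, f k x * g x ∂μ) (∫ x, (∑' k, f k x) * g x ∂μ) := by
  have hi : ∀ k, Integrable (fun x => f k x * g x) μ := fun k =>
    (hf k).mul_bdd hg (.of_forall hC)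
  have := hasSum_integral_of_summable_integral_norm (F := fun k x => f k x * g x) hi ?_
  · simpa only [tsum_mul_right] using this
  · refine Summable.of_nonneg_of_le (fun k => integral_nonneg fun x => norm_nonneg _)
      (fun k => ?_) (hs.mul_right C)
    rw [← integral_mul_const]
    refine integral_mono (hi k).norm ((hf k).norm.mul_const C) fun x => ?_
    simp only [norm_mul]
    exact mul_le_mul_of_nonneg_left (hC x) (norm_nonneg _)

theorem IsTestFunction.exists_bound {n : ℕ} {Ω : Set (EuclideanSpace ℝ (Fin n))}
    {φ : EuclideanSpace ℝ (Fin n) → ℝ} (hφ : IsTestFunction Ω φ) : ∃ C, ∀ x, ‖φ x‖ ≤ C :=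
  hφ.hasCompactSupport.exists_bound_of_continuous hφ.smooth.continuous

theorem hasWeakDeriv_tsum {n : ℕ} {Ω : Set (EuclideanSpace ℝ (Fin n))} {l : List (Fin n)}
    {f : ℕ → EuclideanSpace ℝ (Fin n) → ℝ} (hf : ∀ k, ContDiff ℝ (⊤ : ℕ∞) (f k))
    (hi : ∀ k, IntegrableOn (f k) Ω) (hs : Summable fun k => ∫ x in Ω, ‖f k x‖)
    (hi' : ∀ k, IntegrableOn (iterPartialDeriv l.reverse (f k)) Ω)
    (hs' : Summable fun k => ∫ x in Ω, ‖iterPartialDeriv l.reverse (f k) x‖) :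
    HasWeakDeriv Ω l (fun x => ∑' k, f k x)
      (fun x => ∑' k, iterPartialDeriv l.reverse (f k) x) where
  locallyIntegrableOn_left :=
    IntegrableOn.locallyIntegrableOn (integrable_tsum_of_summable_integral_norm hi hs)
  locallyIntegrableOn_right :=
    IntegrableOn.locallyIntegrableOn (integrable_tsum_of_summable_integral_norm hi' hs')
  integral_eq φ hφ := by
    obtain ⟨C, hC⟩ := hφ.exists_bound
    obtain ⟨C', hC'⟩ := (hφ.iterPartialDeriv l).exists_bound
    have h₁ := hasSum_integral_mul_of_bounded hi hs
      (hφ.iterPartialDeriv l).smooth.continuous.aestronglyMeasurable hC'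
    have h₂ := (hasSum_integral_mul_of_bounded hi' hs'
      hφ.smooth.continuous.aestronglyMeasurable hC).mul_left ((-1) ^ l.length)
    simp_rw [integral_mul_iterPartialDeriv hφ l (hf _)] at h₁
    exact h₁.unique h₂

/-- The fundamental lemma of the calculus of variations. It carries the failure of integrability
from the explicit series to an arbitrary representative of `∂_ii u`. -/
theorem HasWeakDeriv.ae_eq {n : ℕ} {Ω : Set (EuclideanSpace ℝ (Fin n))} (hΩ : IsOpen Ω)
    {l : List (Fin n)} {u g h : EuclideanSpace ℝ (Fin n) → ℝ} (hg : HasWeakDeriv Ω l u g)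
    (hh : HasWeakDeriv Ω l u h) : g =ᵐ[volume.restrict Ω] h := by
  have hl : LocallyIntegrableOn (fun x => g x - h x) Ω :=
    hg.locallyIntegrableOn_right.sub hh.locallyIntegrableOn_right
  have := hΩ.ae_eq_zero_of_integral_contDiff_smul_eq_zero (μ := volume) hl ?_
  · rw [Filter.EventuallyEq, ae_restrict_iff' hΩ.measurableSet]
    filter_upwards [this] with x hx hxΩ using sub_eq_zero.mp (hx hxΩ)
  · intro φ h₁ h₂ h₃
    have hφ : IsTestFunction Ω φ := ⟨h₁, h₂, h₃⟩
    have key : ∀ w : EuclideanSpace ℝ (Fin n) → ℝ,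
        LocallyIntegrableOn w Ω → Integrable fun x => φ x • w x := by
      intro w hw
      obtain ⟨C, hC⟩ := hφ.exists_bound
      have hw' : IntegrableOn w (tsupport φ) := hw.integrableOn_compact_subset h₃ h₂
      have : IntegrableOn (fun x => φ x • w x) (tsupport φ) :=
        hw'.bdd_mul h₁.continuous.aestronglyMeasurable (.of_forall hC)
      refine (integrableOn_iff_integrable_of_support_subset fun x hx => ?_).mp this
      exact subset_tsupport φ (left_ne_zero_of_smul hx)
    have hgi := key g hg.locallyIntegrableOn_right
    have hhi := key h hh.locallyIntegrableOn_right
    simp only [smul_sub]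
    rw [integral_sub hgi hhi]
    have e := (hg.integral_eq φ hφ).symm.trans (hh.integral_eq φ hφ)
    rw [hφ.setIntegral_mul, hφ.setIntegral_mul] at e
    have e' := mul_left_cancel₀ (pow_ne_zero _ (by norm_num)) e
    simp only [smul_eq_mul, mul_comm (φ _)]
    linarith

theorem laplacian_eq_sum_iterPartialDeriv {n : ℕ} {f : EuclideanSpace ℝ (Fin n) → ℝ}
    (hf : ContDiff ℝ (⊤ : ℕ∞) f) (x : EuclideanSpace ℝ (Fin n)) :
    Laplacian.laplacian f x = ∑ i, iterPartialDeriv [i, i] f x := by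
  rw [InnerProductSpace.laplacian_eq_iteratedFDeriv_orthonormalBasis f
    (EuclideanSpace.basisFun (Fin n) ℝ)]
  refine Finset.sum_congr rfl fun i _ => ?_
  have hd : DifferentiableAt ℝ (fderiv ℝ f) x :=
    ((hf.fderiv_right (m := (⊤ : ℕ∞)) (by simp)).differentiable (by simp)) x
  simp only [iterPartialDeriv, List.foldr, iteratedFDeriv_two_apply]
  change _ = fderiv ℝ (fun y => fderiv ℝ f y (EuclideanSpace.single i 1)) x _
  rw [fderiv_clm_apply hd (differentiableAt_const _)]
  simp

/-- Only `L¹` convergence of the series is needed: `Δφ` is bounded, so the pairing is summed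
termwise, and in each term the Laplacian moves back to the smooth `f k`. -/
theorem isDistribSubharmonicOn_tsum {n : ℕ} {Ω : Set (EuclideanSpace ℝ (Fin n))}
    {f : ℕ → EuclideanSpace ℝ (Fin n) → ℝ} (hf : ∀ k, ContDiff ℝ (⊤ : ℕ∞) (f k))
    (hi : ∀ k, IntegrableOn (f k) Ω) (hs : Summable fun k => ∫ x in Ω, ‖f k x‖)
    (hsub : ∀ k x, 0 ≤ Laplacian.laplacian (f k) x) :
    IsDistribSubharmonicOn Ω (fun x => ∑' k, f k x) where
  locallyIntegrableOn :=
    IntegrableOn.locallyIntegrableOn (integrable_tsum_of_summable_integral_norm hi hs)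
  integral_nonneg φ hφ hpos := by
    have ht : ∀ i, IsTestFunction Ω (iterPartialDeriv [i, i] φ) := fun i =>
      hφ.iterPartialDeriv [i, i]
    have hint : ∀ g : EuclideanSpace ℝ (Fin n) → ℝ, Continuous g →
        ∀ ψ, IsTestFunction Ω ψ → IntegrableOn (fun x => g x * ψ x) Ω := fun g hg ψ hψ =>
      ((hg.mul hψ.smooth.continuous).integrable_of_hasCompactSupport
        hψ.hasCompactSupport.mul_left).integrableOn
    have hL : IsTestFunction Ω (Laplacian.laplacian φ) := by
      have hE : Laplacian.laplacian φ = fun x => ∑ i, iterPartialDeriv [i, i] φ x :=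
        funext fun x => laplacian_eq_sum_iterPartialDeriv hφ.smooth x
      have hsupp : tsupport (Laplacian.laplacian φ) ⊆ tsupport φ := by
        refine closure_minimal (fun x hx => ?_) (isClosed_tsupport φ)
        by_contra hxφ
        refine hx ?_
        rw [hE]
        refine Finset.sum_eq_zero fun i _ => ?_
        refine image_eq_zero_of_notMem_tsupport fun h => hxφ ?_
        exact ((tsupport_fderiv_apply_subset ℝ _).trans (tsupport_fderiv_apply_subset ℝ _)) h
      refine ⟨?_, ?_, hsupp.trans hφ.tsupport_subset⟩
      · rw [hE]
        exact ContDiff.sum fun i _ => (ht i).smooth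
      · exact hφ.hasCompactSupport.of_isClosed_subset (isClosed_tsupport _) hsupp
    obtain ⟨C, hC⟩ := hL.exists_bound
    have h₁ := hasSum_integral_mul_of_bounded hi hs hL.smooth.continuous.aestronglyMeasurable hC
    refine h₁.nonneg fun k => ?_
    simp only [laplacian_eq_sum_iterPartialDeriv hφ.smooth, Finset.mul_sum]
    rw [integral_finsetSum _ fun i _ => hint _ (hf k).continuous _ (ht i)]
    simp only [integral_mul_iterPartialDeriv hφ [_, _] (hf k), List.length_cons, List.length_nil,
      List.reverse_cons, List.reverse_nil, List.nil_append, List.cons_append]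
    norm_num
    rw [← integral_finsetSum _ fun i _ =>
      hint _ (iterPartialDeriv_contDiff (hf k) [i, i]).continuous _ hφ]
    refine integral_nonneg fun x => ?_
    simp only [← Finset.sum_mul, ← laplacian_eq_sum_iterPartialDeriv (hf k)]
    exact mul_nonneg (hsub k x) (hpos x)

/-! ### Calculus and Fubini in two coordinates -/

theorem partialDeriv_eq_of_hasDerivAt_fst {i j : Fin 2} (hij : i ≠ j) {F : ℝ → ℝ → ℝ}
    {x : EuclideanSpace ℝ (Fin 2)} {d : ℝ}
    (hF : DifferentiableAt ℝ (fun x : EuclideanSpace ℝ (Fin 2) => F (x i) (x j)) x)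
    (h : HasDerivAt (fun s => F s (x j)) d (x i)) :
    partialDeriv i (fun x => F (x i) (x j)) x = d := by
  have h₁ : HasLineDerivAt ℝ (fun x : EuclideanSpace ℝ (Fin 2) => F (x i) (x j)) d x
      (EuclideanSpace.single i 1) := by
    have := HasDerivAt.scomp_of_eq (h := fun s : ℝ => x i + s) (h' := 1) 0 h
      (by simpa using (hasDerivAt_id (0 : ℝ)).const_add (x i)) (by simp)
    simpa [HasLineDerivAt, Function.comp_def, hij.symm, Pi.single_apply] using this
  exact hF.lineDeriv_eq_fderiv.symm.trans h₁.lineDeriv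

theorem partialDeriv_eq_of_hasDerivAt_snd {i j : Fin 2} (hij : i ≠ j) {F : ℝ → ℝ → ℝ}
    {x : EuclideanSpace ℝ (Fin 2)} {d : ℝ}
    (hF : DifferentiableAt ℝ (fun x : EuclideanSpace ℝ (Fin 2) => F (x i) (x j)) x)
    (h : HasDerivAt (fun s => F (x i) s) d (x j)) :
    partialDeriv j (fun x => F (x i) (x j)) x = d :=
  partialDeriv_eq_of_hasDerivAt_fst (F := fun s t => F t s) hij.symm hF h

theorem Fin.univ_eq_pair {i j : Fin 2} (hij : i ≠ j) : (Finset.univ : Finset (Fin 2)) = {i, j} := by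
  symm
  rw [Finset.eq_univ_iff_forall]
  intro k
  rw [Finset.mem_insert, Finset.mem_singleton]
  omega

theorem integral_mul_coord {i j : Fin 2} (hij : i ≠ j) (f g : ℝ → ℝ) :
    ∫ x : EuclideanSpace ℝ (Fin 2), f (x i) * g (x j) = (∫ s, f s) * ∫ s, g s := by
  have h := integral_fintype_prod_volume_eq_prod (ι := Fin 2) (E := fun _ => ℝ)
    (fun k => if k = i then f else g)
  simp only [Fin.univ_eq_pair hij, Finset.prod_pair hij, if_true, hij.symm, if_false] at h
  rw [← h, ← (PiLp.volume_preserving_toLp (Fin 2)).integral_comp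
    (MeasurableEquiv.toLp 2 (Fin 2 → ℝ)).measurableEmbedding]

theorem integrable_mul_coord {i j : Fin 2} (hij : i ≠ j) {f g : ℝ → ℝ} (hf : Integrable f)
    (hg : Integrable g) :
    Integrable fun x : EuclideanSpace ℝ (Fin 2) => f (x i) * g (x j) := by
  have h := Integrable.fintype_prod (ι := Fin 2) (E := ℝ) (μ := fun _ => volume)
    (f := fun k : Fin 2 => if k = i then f else g) (fun k => by split_ifs <;> assumption)
  simp only [Fin.univ_eq_pair hij, Finset.prod_pair hij, if_true, hij.symm, if_false] at h
  rw [← (PiLp.volume_preserving_toLp (Fin 2)).integrable_comp_emb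
    (MeasurableEquiv.toLp 2 (Fin 2 → ℝ)).measurableEmbedding]
  exact h

/-! ### The building block and its derivatives -/

/-- A smoothed multiple of `|y - c|`, plus an oscillation of wavelength `r` in `s` which is
concentrated at distance about `r` from the line `y = c`. -/
def rippleProfile (r c s y : ℝ) : ℝ :=
  r * (3 * ((y - c) / r * Real.arctan ((y - c) / r) - Real.log (1 + ((y - c) / r) ^ 2) / 2)
    + Real.cos (s / r) * (1 + ((y - c) / r) ^ 2)⁻¹)

/-- The function `rippleProfile r c (x i) (x j)` on the plane, normalised to vanish at `0`. -/
def ripple (i j : Fin 2) (r c : ℝ) (x : EuclideanSpace ℝ (Fin 2)) : ℝ :=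
  rippleProfile r c (x i) (x j) - rippleProfile r c 0 0

variable {i j : Fin 2} {r c : ℝ}

theorem ripple_contDiff (i j : Fin 2) (r c : ℝ) : ContDiff ℝ (⊤ : ℕ∞) (ripple i j r c) := by
  have hp : ∀ x : EuclideanSpace ℝ (Fin 2), 1 + ((x j - c) / r) ^ 2 ≠ 0 := fun x => by positivity
  have ht : ContDiff ℝ (⊤ : ℕ∞) fun x : EuclideanSpace ℝ (Fin 2) => (x j - c) / r := by fun_prop
  have hq : ContDiff ℝ (⊤ : ℕ∞) fun x : EuclideanSpace ℝ (Fin 2) => 1 + ((x j - c) / r) ^ 2 := by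
    fun_prop
  have hs : ContDiff ℝ (⊤ : ℕ∞) fun x : EuclideanSpace ℝ (Fin 2) => x i / r := by fun_prop
  unfold ripple rippleProfile
  exact (contDiff_const.mul ((contDiff_const.mul ((ht.mul ht.arctan).sub
    ((hq.log hp).div_const 2))).add (hs.cos.mul (hq.inv hp)))).sub contDiff_const

theorem hasDerivAt_lorentz (hr : r ≠ 0) (y : ℝ) :
    HasDerivAt (fun y => (1 + ((y - c) / r) ^ 2)⁻¹)
      (-2 * ((y - c) / r) * (1 + ((y - c) / r) ^ 2)⁻¹ ^ 2 / r) y := by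
  have ht : HasDerivAt (fun y => (y - c) / r) (1 / r) y :=
    ((hasDerivAt_id y).sub_const c).div_const r
  have hp : 1 + ((y - c) / r) ^ 2 ≠ 0 := by positivity
  convert! ((ht.pow 2).const_add 1).inv hp using 1
  simp only [Pi.pow_apply]
  generalize (y - c) / r = t at *
  norm_num
  field_simp

theorem partialDeriv_ripple_fst (hij : i ≠ j) (hr : r ≠ 0) :
    partialDeriv i (ripple i j r c) =
      fun x => -Real.sin (x i / r) * (1 + ((x j - c) / r) ^ 2)⁻¹ := by
  funext x
  refine partialDeriv_eq_of_hasDerivAt_fst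
    (F := fun s y => rippleProfile r c s y - rippleProfile r c 0 0) hij
    ((ripple_contDiff i j r c).differentiable (by simp) x) ?_
  have hs : HasDerivAt (fun s => s / r) (1 / r) (x i) := (hasDerivAt_id _).div_const r
  refine HasDerivAt.sub_const _ ?_
  unfold rippleProfile
  convert! ((hs.cos.mul_const ((1 + ((x j - c) / r) ^ 2)⁻¹)).const_add
    (3 * ((x j - c) / r * Real.arctan ((x j - c) / r) - Real.log (1 + ((x j - c) / r) ^ 2) / 2))
    ).const_mul r using 1
  field_simp

theorem partialDeriv_ripple_snd (hij : i ≠ j) (hr : r ≠ 0) :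
    partialDeriv j (ripple i j r c) =
      fun x => 3 * Real.arctan ((x j - c) / r) +
        Real.cos (x i / r) * (-2 * ((x j - c) / r) * (1 + ((x j - c) / r) ^ 2)⁻¹ ^ 2) := by
  funext x
  refine partialDeriv_eq_of_hasDerivAt_snd
    (F := fun s y => rippleProfile r c s y - rippleProfile r c 0 0) hij
    ((ripple_contDiff i j r c).differentiable (by simp) x) ?_
  have ht : HasDerivAt (fun y => (y - c) / r) (1 / r) (x j) :=
    ((hasDerivAt_id _).sub_const c).div_const r
  have hp : 1 + ((x j - c) / r) ^ 2 ≠ 0 := by positivity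
  refine HasDerivAt.sub_const _ ?_
  unfold rippleProfile
  convert! ((((ht.mul ht.arctan).sub ((((ht.pow 2).const_add 1).log hp).div_const 2)).const_mul
    3).add ((hasDerivAt_lorentz (c := c) hr (x j)).const_mul (Real.cos (x i / r)))).const_mul r
    using 1
  simp only [Pi.pow_apply]
  generalize (x j - c) / r = t at *
  norm_num
  field_simp
  ring

theorem iterPartialDeriv_ripple_fst_fst (hij : i ≠ j) (hr : r ≠ 0) :
    iterPartialDeriv [i, i] (ripple i j r c) =
      fun x => -(1 / r) * (Real.cos (x i / r) * (1 + ((x j - c) / r) ^ 2)⁻¹) := by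
  have hd := (partialDeriv_contDiff (ripple_contDiff i j r c) i).differentiable (by simp)
  change partialDeriv i (partialDeriv i (ripple i j r c)) = _
  rw [partialDeriv_ripple_fst hij hr] at hd ⊢
  funext x
  refine partialDeriv_eq_of_hasDerivAt_fst
    (F := fun s y => -Real.sin (s / r) * (1 + ((y - c) / r) ^ 2)⁻¹) hij (hd x) ?_
  have hs : HasDerivAt (fun s => s / r) (1 / r) (x i) := (hasDerivAt_id _).div_const r
  convert! hs.sin.neg.mul_const ((1 + ((x j - c) / r) ^ 2)⁻¹) using 1
  ring

theorem iterPartialDeriv_ripple_snd_fst (hij : i ≠ j) (hr : r ≠ 0) :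
    iterPartialDeriv [j, i] (ripple i j r c) =
      fun x => -Real.sin (x i / r) *
        (-2 * ((x j - c) / r) * (1 + ((x j - c) / r) ^ 2)⁻¹ ^ 2 / r) := by
  have hd := (partialDeriv_contDiff (ripple_contDiff i j r c) i).differentiable (by simp)
  change partialDeriv j (partialDeriv i (ripple i j r c)) = _
  rw [partialDeriv_ripple_fst hij hr] at hd ⊢
  funext x
  exact partialDeriv_eq_of_hasDerivAt_snd
    (F := fun s y => -Real.sin (s / r) * (1 + ((y - c) / r) ^ 2)⁻¹) hij (hd x)
    ((hasDerivAt_lorentz hr (x j)).const_mul _)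

theorem iterPartialDeriv_ripple_fst_snd (hij : i ≠ j) (hr : r ≠ 0) :
    iterPartialDeriv [i, j] (ripple i j r c) =
      fun x => -Real.sin (x i / r) *
        (-2 * ((x j - c) / r) * (1 + ((x j - c) / r) ^ 2)⁻¹ ^ 2 / r) := by
  have hd := (partialDeriv_contDiff (ripple_contDiff i j r c) j).differentiable (by simp)
  change partialDeriv i (partialDeriv j (ripple i j r c)) = _
  rw [partialDeriv_ripple_snd hij hr] at hd ⊢
  funext x
  refine partialDeriv_eq_of_hasDerivAt_fst
    (F := fun s y => 3 * Real.arctan ((y - c) / r) +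
        Real.cos (s / r) * (-2 * ((y - c) / r) * (1 + ((y - c) / r) ^ 2)⁻¹ ^ 2)) hij (hd x) ?_
  have hs : HasDerivAt (fun s => s / r) (1 / r) (x i) := (hasDerivAt_id _).div_const r
  convert! (hs.cos.mul_const _).const_add _ using 1
  ring

theorem iterPartialDeriv_ripple_snd_snd (hij : i ≠ j) (hr : r ≠ 0) :
    iterPartialDeriv [j, j] (ripple i j r c) =
      fun x => 1 / r * (1 + ((x j - c) / r) ^ 2)⁻¹ *
        (3 + Real.cos (x i / r) * (-2 * (1 + ((x j - c) / r) ^ 2)⁻¹ +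
          8 * ((x j - c) / r) ^ 2 * (1 + ((x j - c) / r) ^ 2)⁻¹ ^ 2)) := by
  have hd := (partialDeriv_contDiff (ripple_contDiff i j r c) j).differentiable (by simp)
  change partialDeriv j (partialDeriv j (ripple i j r c)) = _
  rw [partialDeriv_ripple_snd hij hr] at hd ⊢
  funext x
  refine partialDeriv_eq_of_hasDerivAt_snd
    (F := fun s y => 3 * Real.arctan ((y - c) / r) +
        Real.cos (s / r) * (-2 * ((y - c) / r) * (1 + ((y - c) / r) ^ 2)⁻¹ ^ 2)) hij (hd x) ?_
  have ht : HasDerivAt (fun y => (y - c) / r) (1 / r) (x j) :=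
    ((hasDerivAt_id _).sub_const c).div_const r
  have hp : 1 + ((x j - c) / r) ^ 2 ≠ 0 := by positivity
  convert! (ht.arctan.const_mul 3).add (((ht.const_mul (-2)).mul
    ((hasDerivAt_lorentz hr (x j)).pow 2)).const_mul (Real.cos (x i / r))) using 1
  simp only [Pi.pow_apply]
  generalize (x j - c) / r = t at *
  norm_num
  field_simp
  ring

/-! ### Bounds for the building block, uniform in `r` and `c` -/

theorem abs_two_mul_mul_inv_sq_le (t : ℝ) :
    |-2 * t * (1 + t ^ 2)⁻¹ ^ 2| ≤ (1 + t ^ 2)⁻¹ := by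
  have hq : 0 < (1 + t ^ 2)⁻¹ := by positivity
  have hle : |2 * t| * (1 + t ^ 2)⁻¹ ≤ 1 := by
    rw [← div_eq_mul_inv, div_le_one (by positivity), abs_le]
    constructor <;> nlinarith [sq_nonneg (t - 1), sq_nonneg (t + 1)]
  have e : |-2 * t * (1 + t ^ 2)⁻¹ ^ 2| = |2 * t| * (1 + t ^ 2)⁻¹ * (1 + t ^ 2)⁻¹ := by
    rw [abs_mul, abs_pow, sq_abs, neg_mul, abs_neg]
    ring
  rw [e]
  exact mul_le_of_le_one_left hq.le hle

theorem abs_iterPartialDeriv_ripple_le (hij : i ≠ j) (hr : 0 < r) (a b : Fin 2)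
    (x : EuclideanSpace ℝ (Fin 2)) :
    |iterPartialDeriv [a, b] (ripple i j r c) x| ≤ 5 / r * (1 + ((x j - c) / r) ^ 2)⁻¹ := by
  have key : ∀ s t : ℝ, |s| ≤ 1 →
      |-s * (-2 * t * (1 + t ^ 2)⁻¹ ^ 2 / r)| ≤ 5 / r * (1 + t ^ 2)⁻¹ := by
    intro s t hs
    rw [abs_mul, abs_neg, abs_div, abs_of_pos hr, div_mul_eq_mul_div, ← mul_div_assoc]
    refine div_le_div_of_nonneg_right ?_ hr.le
    have hq : 0 < (1 + t ^ 2)⁻¹ := by positivity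
    have := mul_le_mul hs (abs_two_mul_mul_inv_sq_le t) (abs_nonneg _) zero_le_one
    linarith
  have ha : a = i ∨ a = j := by omega
  have hb : b = i ∨ b = j := by omega
  rcases ha with rfl | rfl <;> rcases hb with rfl | rfl
  · rw [iterPartialDeriv_ripple_fst_fst hij hr.ne', abs_mul, abs_mul, abs_neg,
      abs_of_pos (by positivity : 0 < 1 / r),
      abs_of_pos (by positivity : 0 < (1 + ((x j - c) / r) ^ 2)⁻¹), ← mul_assoc]
    gcongr
    rw [div_mul_eq_mul_div]
    gcongr
    linarith [Real.abs_cos_le_one (x b / r)]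
  · rw [iterPartialDeriv_ripple_fst_snd hij hr.ne']
    exact key _ _ (Real.abs_sin_le_one _)
  · rw [iterPartialDeriv_ripple_snd_fst hij hr.ne']
    exact key _ _ (Real.abs_sin_le_one _)
  · rw [iterPartialDeriv_ripple_snd_snd hij hr.ne']
    dsimp only
    generalize (x b - c) / r = t
    have hC := abs_le.mp (Real.abs_cos_le_one (x i / r))
    generalize Real.cos (x i / r) = C at hC
    have hq : 0 < (1 + t ^ 2)⁻¹ := by positivity
    have hq1 : t ^ 2 * (1 + t ^ 2)⁻¹ = 1 - (1 + t ^ 2)⁻¹ := by field_simp; ring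
    generalize (1 + t ^ 2)⁻¹ = q at hq hq1
    have hq2 : q ≤ 1 := by nlinarith [sq_nonneg t]
    -- Since `t² q = 1 - q`, everything is a polynomial in `q ∈ (0, 1]`. There `|6q - 8q²| ≤ 2`, so
    -- the constant is `5 = 3 + 2`.
    have e : -2 * q + 8 * t ^ 2 * q ^ 2 = 6 * q - 8 * q ^ 2 := by linear_combination 8 * q * hq1
    rw [e, abs_mul, abs_mul, abs_of_pos hq, abs_of_pos (by positivity : 0 < 1 / r)]
    have h5 : |3 + C * (6 * q - 8 * q ^ 2)| ≤ 5 := by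
      have : |C * (6 * q - 8 * q ^ 2)| ≤ 1 * 2 := by
        rw [abs_mul]
        exact mul_le_mul (abs_le.mpr hC) (abs_le.mpr ⟨by nlinarith, by nlinarith [sq_nonneg (q - 1)]⟩)
          (abs_nonneg _) zero_le_one
      have := abs_le.mp this
      exact abs_le.mpr ⟨by linarith, by linarith⟩
    calc 1 / r * q * |3 + C * (6 * q - 8 * q ^ 2)| ≤ 1 / r * q * 5 := by gcongr
      _ = 5 / r * q := by ring

/-- With `q = 1 / (1 + t²)` and `C` the cosine, the Laplacian is `(q / r) (3 + C (6q - 8q² - 1))`.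
The bracket multiplying `C` lies in `[-3, 3]` and equals `-3` at `q = 1`, which is why the convex
part carries the coefficient `3`. -/
theorem laplacian_ripple_nonneg (hij : i ≠ j) (hr : 0 < r) (x : EuclideanSpace ℝ (Fin 2)) :
    0 ≤ Laplacian.laplacian (ripple i j r c) x := by
  rw [laplacian_eq_sum_iterPartialDeriv (ripple_contDiff i j r c), Fin.univ_eq_pair hij,
    Finset.sum_pair hij,
    iterPartialDeriv_ripple_fst_fst hij hr.ne', iterPartialDeriv_ripple_snd_snd hij hr.ne']
  dsimp only
  generalize (x j - c) / r = t
  have hC := abs_le.mp (Real.abs_cos_le_one (x i / r))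
  generalize Real.cos (x i / r) = C at hC
  have hq : 0 < (1 + t ^ 2)⁻¹ := by positivity
  have hq1 : t ^ 2 * (1 + t ^ 2)⁻¹ = 1 - (1 + t ^ 2)⁻¹ := by field_simp; ring
  generalize (1 + t ^ 2)⁻¹ = q at hq hq1
  have hq2 : q ≤ 1 := by nlinarith [sq_nonneg t]
  have e : -(1 / r) * (C * q) + 1 / r * q * (3 + C * (-2 * q + 8 * t ^ 2 * q ^ 2)) =
      1 / r * q * (3 + C * (6 * q - 8 * q ^ 2 - 1)) := by linear_combination 8 / r * C * q ^ 2 * hq1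
  rw [e]
  have : |C * (6 * q - 8 * q ^ 2 - 1)| ≤ 1 * 3 := by
    rw [abs_mul]
    exact mul_le_mul (abs_le.mpr hC) (abs_le.mpr ⟨by nlinarith, by nlinarith [sq_nonneg (q - 1)]⟩)
      (abs_nonneg _) zero_le_one
  have := abs_le.mp this
  have : 0 ≤ 3 + C * (6 * q - 8 * q ^ 2 - 1) := by linarith
  positivity

theorem abs_partialDeriv_ripple_le (hij : i ≠ j) (hr : r ≠ 0) (a : Fin 2)
    (x : EuclideanSpace ℝ (Fin 2)) : |partialDeriv a (ripple i j r c) x| ≤ 6 := by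
  have ha : a = i ∨ a = j := by omega
  have hle : (1 + ((x j - c) / r) ^ 2)⁻¹ ≤ 1 :=
    inv_le_one_of_one_le₀ (by nlinarith [sq_nonneg ((x j - c) / r)])
  have hq : 0 < (1 + ((x j - c) / r) ^ 2)⁻¹ := by positivity
  rcases ha with rfl | rfl
  · rw [partialDeriv_ripple_fst hij hr, abs_mul, abs_neg, abs_of_pos hq]
    have := mul_le_mul (Real.abs_sin_le_one (x a / r)) hle hq.le zero_le_one
    linarith
  · rw [partialDeriv_ripple_snd hij hr]
    have h₁ := mul_le_mul (Real.abs_cos_le_one (x i / r))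
      ((abs_two_mul_mul_inv_sq_le ((x a - c) / r)).trans hle) (abs_nonneg _) zero_le_one
    rw [← abs_mul, abs_le] at h₁
    have h₂ := Real.arctan_lt_pi_div_two ((x a - c) / r)
    have h₃ := Real.neg_pi_div_two_lt_arctan ((x a - c) / r)
    -- The bound `6` comes from `3π/2 + 1 < 6`.
    have h₄ := Real.pi_lt_d2
    exact abs_le.mpr ⟨by linarith, by linarith⟩

theorem lipschitzWith_ripple (hij : i ≠ j) (hr : r ≠ 0) :
    LipschitzWith 12 (ripple i j r c) := by
  refine lipschitzWith_of_nnnorm_fderiv_le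
    ((ripple_contDiff i j r c).differentiable (by simp)) fun x => ?_
  rw [← NNReal.coe_le_coe, coe_nnnorm]
  refine ContinuousLinearMap.opNorm_le_bound _ (by simp) fun v => ?_
  have hv : v = ∑ k, v k • EuclideanSpace.single k (1 : ℝ) := by
    simpa using ((EuclideanSpace.basisFun (Fin 2) ℝ).sum_repr v).symm
  conv_lhs => rw [hv]
  rw [map_sum, Fin.sum_univ_two, map_smul, map_smul]
  have hb : ∀ k, ‖v k • fderiv ℝ (ripple i j r c) x (EuclideanSpace.single k 1)‖ ≤ 6 * ‖v‖ := by
    intro k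
    rw [norm_smul, mul_comm]
    exact mul_le_mul (abs_partialDeriv_ripple_le hij hr k x) (PiLp.norm_apply_le v k)
      (norm_nonneg _) (by norm_num)
  refine (norm_add_le _ _).trans ((add_le_add (hb 0) (hb 1)).trans (le_of_eq ?_))
  push_cast
  ring

theorem ripple_zero : ripple i j r c 0 = 0 := by simp [ripple]

/-- Vanishing at the origin makes this uniform in `c`, which is needed because the centres used are
unbounded. -/
theorem abs_ripple_le (hij : i ≠ j) (hr : r ≠ 0) (x : EuclideanSpace ℝ (Fin 2)) :
    |ripple i j r c x| ≤ 12 * ‖x‖ := by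
  simpa [ripple_zero] using (lipschitzWith_ripple (c := c) hij hr).norm_sub_le x 0

theorem integrable_scaled_lorentz (hr : 0 < r) (c : ℝ) :
    Integrable fun y : ℝ => 5 / r * (1 + ((y - c) / r) ^ 2)⁻¹ :=
  ((integrable_inv_one_add_sq.comp_div hr.ne').comp_sub_right c).const_mul _

theorem integral_scaled_lorentz (hr : 0 < r) (c : ℝ) :
    ∫ y : ℝ, 5 / r * (1 + ((y - c) / r) ^ 2)⁻¹ = 5 * Real.pi := by
  rw [integral_const_mul, integral_sub_right_eq_self (fun y => (1 + (y / r) ^ 2)⁻¹) c,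
    Measure.integral_comp_div (fun y => (1 + y ^ 2)⁻¹) r, integral_univ_inv_one_add_sq,
    abs_of_pos hr, smul_eq_mul]
  field_simp

theorem integral_norm_iterPartialDeriv_ripple_le (hij : i ≠ j) (hr : 0 < r) (a b : Fin 2) :
    ∫ x in Metric.ball 0 1, ‖iterPartialDeriv [a, b] (ripple i j r c) x‖ ≤ 10 * Real.pi := by
  -- The ball is enlarged to the slab `|x i| ≤ 1`, where the majorant factorises: `2 · 5π`.
  set f : ℝ → ℝ := (Set.Icc (-1) 1).indicator fun _ => 1
  set g : ℝ → ℝ := fun y => 5 / r * (1 + ((y - c) / r) ^ 2)⁻¹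
  have hfi : Integrable f := (integrable_indicator_iff measurableSet_Icc).mpr
    (integrableOn_const (by simp))
  have hfg : Integrable fun x : EuclideanSpace ℝ (Fin 2) => f (x i) * g (x j) :=
    integrable_mul_coord hij hfi (integrable_scaled_lorentz hr c)
  have hf0 : ∀ s, 0 ≤ f s := fun s => Set.indicator_nonneg (fun _ _ => zero_le_one) s
  have hg0 : ∀ s, 0 ≤ g s := fun s => by positivity
  calc ∫ x in Metric.ball 0 1, ‖iterPartialDeriv [a, b] (ripple i j r c) x‖
      ≤ ∫ x in Metric.ball (0 : EuclideanSpace ℝ (Fin 2)) 1, f (x i) * g (x j) := by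
        refine setIntegral_mono_on ?_ hfg.integrableOn measurableSet_ball fun x hx => ?_
        · have := (iterPartialDeriv_contDiff (ripple_contDiff i j r c) [a, b]).continuous.norm
          exact (this.continuousOn.integrableOn_compact
            (isCompact_closedBall 0 1)).mono_set Metric.ball_subset_closedBall
        · have hxi : x i ∈ Set.Icc (-1 : ℝ) 1 := by
            have h₁ := PiLp.norm_apply_le x i
            have h₂ := mem_ball_zero_iff.mp hx
            exact abs_le.mp (h₁.trans h₂.le)
          simp only [f, Set.indicator_of_mem hxi, one_mul]
          exact abs_iterPartialDeriv_ripple_le hij hr a b x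
    _ ≤ ∫ x : EuclideanSpace ℝ (Fin 2), f (x i) * g (x j) :=
        setIntegral_le_integral hfg (.of_forall fun x => mul_nonneg (hf0 _) (hg0 _))
    _ = 10 * Real.pi := by
        rw [integral_mul_coord hij, integral_scaled_lorentz hr c,
          integral_indicator_const _ measurableSet_Icc]
        simp
        ring

theorem integral_norm_iterPartialDeriv_ripple_le_of_length_le (hij : i ≠ j) (hr : 0 < r)
    {l : List (Fin 2)} (hl : l.length ≤ 2) :
    ∫ x in Metric.ball 0 1, ‖iterPartialDeriv l (ripple i j r c) x‖ ≤
      12 * volume.real (Metric.ball (0 : EuclideanSpace ℝ (Fin 2)) 1) + 10 * Real.pi := by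
  have hbd : ∀ f : EuclideanSpace ℝ (Fin 2) → ℝ, (∀ x ∈ Metric.ball 0 1, |f x| ≤ 12) →
      ∫ x in Metric.ball 0 1, ‖f x‖ ≤
        12 * volume.real (Metric.ball (0 : EuclideanSpace ℝ (Fin 2)) 1) + 10 * Real.pi := by
    intro f hf
    have := norm_setIntegral_le_of_norm_le_const (μ := volume) (f := fun x => ‖f x‖)
      (s := Metric.ball (0 : EuclideanSpace ℝ (Fin 2)) 1) (C := 12) measure_ball_lt_top
      fun x hx => by simpa using hf x hx
    have h' := (le_abs_self _).trans this
    linarith [Real.pi_pos]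
  match l, hl with
  | [], _ =>
    refine hbd _ fun x hx => (abs_ripple_le hij hr.ne' x).trans ?_
    linarith [mem_ball_zero_iff.mp hx]
  | [a], _ => exact hbd _ fun x _ => (abs_partialDeriv_ripple_le hij hr.ne' a x).trans (by norm_num)
  | [a, b], _ =>
    refine (integral_norm_iterPartialDeriv_ripple_le hij hr a b).trans ?_
    linarith [measureReal_nonneg (μ := volume) (s := Metric.ball (0 : EuclideanSpace ℝ (Fin 2)) 1)]

/-! ### Thin strips and the mass of a single ripple -/

/-- The rectangle `|x i - p| ≤ d`, `|x j - c| ≤ r`. -/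
def strip (i j : Fin 2) (p d c r : ℝ) : Set (EuclideanSpace ℝ (Fin 2)) :=
  {x | x i ∈ Set.Icc (p - d) (p + d) ∧ x j ∈ Set.Icc (c - r) (c + r)}

theorem measurableSet_strip {p d : ℝ} : MeasurableSet (strip i j p d c r) := by
  have hm : ∀ k : Fin 2, Measurable fun x : EuclideanSpace ℝ (Fin 2) => x k := fun k => by fun_prop
  exact (hm i measurableSet_Icc).inter (hm j measurableSet_Icc)

theorem setIntegral_strip_mul (hij : i ≠ j) {p d : ℝ} (f g : ℝ → ℝ) :
    ∫ x in strip i j p d c r, f (x i) * g (x j) =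
      (∫ s in Set.Icc (p - d) (p + d), f s) * ∫ s in Set.Icc (c - r) (c + r), g s := by
  rw [← integral_indicator measurableSet_strip, ← integral_indicator measurableSet_Icc,
    ← integral_indicator measurableSet_Icc, ← integral_mul_coord hij]
  congr 1 with x
  by_cases h₁ : x i ∈ Set.Icc (p - d) (p + d) <;> by_cases h₂ : x j ∈ Set.Icc (c - r) (c + r) <;>
    simp only [Set.indicator, strip, Set.mem_ofPred_eq, h₁, h₂] <;> simp

theorem volume_real_strip (hij : i ≠ j) {p d : ℝ} (hd : 0 ≤ d) (hr : 0 ≤ r) :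
    volume.real (strip i j p d c r) = 4 * d * r := by
  have h := setIntegral_strip_mul hij (p := p) (d := d) (c := c) (r := r) (fun _ => 1) fun _ => 1
  simp only [setIntegral_const, smul_eq_mul, mul_one, Real.volume_real_Icc] at h
  rw [h, max_eq_left (by linarith), max_eq_left (by linarith)]
  ring

theorem le_setIntegral_strip_ripple (hij : i ≠ j) (hr : 0 < r) {p d : ℝ} (hd : 5 * r ≤ d) :
    d / 4 ≤ ∫ x in strip i j p d c r, -iterPartialDeriv [i, i] (ripple i j r c) x *
      ((1 + Real.cos (x i / r)) / 2) := by
  have e : ∀ x : EuclideanSpace ℝ (Fin 2), -iterPartialDeriv [i, i] (ripple i j r c) x *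
      ((1 + Real.cos (x i / r)) / 2) = (Real.cos (x i / r) * ((1 + Real.cos (x i / r)) / 2)) *
        (1 / r * (1 + ((x j - c) / r) ^ 2)⁻¹) := fun x => by
    rw [iterPartialDeriv_ripple_fst_fst hij hr.ne']
    ring
  simp only [e]
  rw [setIntegral_strip_mul hij (fun s => Real.cos (s / r) * ((1 + Real.cos (s / r)) / 2))
    fun y => 1 / r * (1 + ((y - c) / r) ^ 2)⁻¹]
  -- The mean of the integrand is `1/4`, giving `d/2` over length `2d`. The oscillating part of the
  -- primitive costs at most `5r/4 ≤ d/4`.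
  have h₁ : d / 4 ≤
      ∫ s in Set.Icc (p - d) (p + d), Real.cos (s / r) * ((1 + Real.cos (s / r)) / 2) := by
    rw [integral_Icc_eq_integral_Ioc, ← intervalIntegral.integral_of_le (by linarith)]
    have hF : ∀ s : ℝ, HasDerivAt
        (fun s => r / 2 * Real.sin (s / r) + s / 4 + r / 8 * Real.sin (2 * (s / r)))
        (Real.cos (s / r) * ((1 + Real.cos (s / r)) / 2)) s := fun s => by
      have hs : HasDerivAt (fun s => s / r) (1 / r) s := (hasDerivAt_id _).div_const r
      convert! ((hs.sin.const_mul (r / 2)).add ((hasDerivAt_id s).div_const 4)).add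
        ((hs.const_mul 2).sin.const_mul (r / 8)) using 1
      rw [Real.cos_two_mul]
      field_simp
      ring
    rw [intervalIntegral.integral_eq_sub_of_hasDerivAt (fun s _ => hF s)
      (Continuous.intervalIntegrable (by fun_prop) _ _)]
    have b := fun t : ℝ => And.intro (mul_le_mul_of_nonneg_left (Real.sin_le_one t) hr.le)
      (mul_le_mul_of_nonneg_left (Real.neg_one_le_sin t) hr.le)
    have b₁ := (b ((p + d) / r)).2
    have b₂ := (b (2 * ((p + d) / r))).2
    have b₃ := (b ((p - d) / r)).1
    have b₄ := (b (2 * ((p - d) / r))).1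
    linarith
  have h₂ : 1 ≤ ∫ y in Set.Icc (c - r) (c + r), 1 / r * (1 + ((y - c) / r) ^ 2)⁻¹ := by
    have hc : ∫ y in Set.Icc (c - r) (c + r), 1 / (2 * r) = 1 := by
      rw [setIntegral_const, Real.volume_real_Icc, max_eq_left (by linarith), smul_eq_mul]
      field_simp
      ring
    have hcont : Continuous fun y : ℝ => 1 / r * (1 + ((y - c) / r) ^ 2)⁻¹ :=
      continuous_const.mul (Continuous.inv₀ (by fun_prop) fun y => by positivity)
    refine hc.symm.trans_le ?_
    refine setIntegral_mono_on (integrableOn_const (by simp))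
      (hcont.continuousOn.integrableOn_compact isCompact_Icc) measurableSet_Icc fun y hy => ?_
    have ht : ((y - c) / r) ^ 2 ≤ 1 := by
      rw [sq_le_one_iff_abs_le_one, abs_div, abs_of_pos hr, div_le_one hr, abs_le]
      exact ⟨by linarith [hy.1], by linarith [hy.2]⟩
    calc 1 / (2 * r) = 1 / r * (2 : ℝ)⁻¹ := by field_simp
      _ ≤ _ := by gcongr; linarith
  calc d / 4 = d / 4 * 1 := (mul_one _).symm
    _ ≤ _ := mul_le_mul h₁ h₂ zero_le_one (by linarith)

/-! ### Arithmetic of amplitudes and wavelengths -/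

/-- The coefficients of the series of ripples. -/
def amplitude (k : ℕ) : ℝ := (1 / 2) ^ k ^ 2

/-- The wavelengths of the series of ripples. -/
def wavelength (k : ℕ) : ℝ := (1 / 2) ^ k ^ 4

theorem amplitude_pos (k : ℕ) : 0 < amplitude k := by unfold amplitude; positivity

theorem wavelength_pos (k : ℕ) : 0 < wavelength k := by unfold wavelength; positivity

theorem amplitude_le (k m : ℕ) :
    amplitude (m + (k + 1)) ≤ amplitude k * (1 / 2) ^ (k + 1) * (1 / 2) ^ m := by
  unfold amplitude
  rw [← pow_add, ← pow_add]
  exact pow_le_pow_of_le_one (by norm_num) (by norm_num) (by nlinarith [Nat.zero_le (k * m)])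

theorem summable_amplitude : Summable amplitude := by
  rw [← summable_nat_add_iff 1]
  exact Summable.of_nonneg_of_le (fun m => (amplitude_pos _).le) (fun m => amplitude_le 0 m)
    (summable_geometric_two.mul_left _)

theorem tsum_amplitude_le (k : ℕ) :
    ∑' m, amplitude (m + (k + 1)) ≤ amplitude k * (1 / 2) ^ k := by
  calc ∑' m, amplitude (m + (k + 1)) ≤ ∑' m, amplitude k * (1 / 2) ^ (k + 1) * (1 / 2) ^ m :=
        ((summable_nat_add_iff (k + 1)).mpr summable_amplitude).tsum_le_tsum (amplitude_le k)
          (summable_geometric_two.mul_left _)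
    _ = amplitude k * (1 / 2) ^ k := by
        rw [tsum_mul_left, tsum_geometric_two]
        ring

/-- The gap `k⁴ - l⁴` in the wavelength exponents absorbs all the quadratic ones. The factor `2` is
needed: equality holds at `l = 0`, `k = 1`. -/
theorem amplitude_div_wavelength_mul_le {l k : ℕ} (h : l < k) :
    amplitude l / wavelength l * wavelength k ≤ 2 * (amplitude k * (1 / 2) ^ k) * (1 / 2) ^ l := by
  obtain ⟨m, rfl⟩ := Nat.exists_eq_add_of_lt h
  rw [div_mul_eq_mul_div, div_le_iff₀ (wavelength_pos l)]
  unfold amplitude wavelength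
  have e : ∀ A B C D : ℕ, 2 * ((1 / 2 : ℝ) ^ A * (1 / 2) ^ B) * (1 / 2) ^ C * (1 / 2) ^ D =
      2 * (1 / 2) ^ (A + B + C + D) := fun A B C D => by ring
  have e' : ∀ A B : ℕ, (1 / 2 : ℝ) ^ A * (1 / 2) ^ B = 2 * (1 / 2) ^ (A + B + 1) :=
    fun A B => by ring
  rw [e, e']
  refine mul_le_mul_of_nonneg_left ?_ zero_le_two
  refine pow_le_pow_of_le_one (by norm_num) (by norm_num) ?_
  ring_nf
  nlinarith [Nat.zero_le l, Nat.zero_le m, Nat.zero_le (l * m), Nat.zero_le (l ^ 2),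
    Nat.zero_le (m ^ 2), Nat.zero_le (l ^ 3), Nat.zero_le (l ^ 2 * m), Nat.zero_le (l * m ^ 2),
    Nat.zero_le (m ^ 3), Nat.zero_le (l ^ 3 * m), Nat.zero_le (l ^ 2 * m ^ 2),
    Nat.zero_le (l * m ^ 3), Nat.zero_le (m ^ 4)]

theorem sum_amplitude_div_wavelength_mul_le (k : ℕ) :
    (∑ l ∈ Finset.range k, amplitude l / wavelength l) * wavelength k ≤
      4 * (amplitude k * (1 / 2) ^ k) := by
  rw [Finset.sum_mul]
  calc ∑ l ∈ Finset.range k, amplitude l / wavelength l * wavelength k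
      ≤ ∑ l ∈ Finset.range k, 2 * (amplitude k * (1 / 2) ^ k) * (1 / 2) ^ l :=
        Finset.sum_le_sum fun l hl =>
          amplitude_div_wavelength_mul_le (Finset.mem_range.mp hl)
    _ ≤ 2 * (amplitude k * (1 / 2) ^ k) * 2 := by
        rw [← Finset.mul_sum]
        have := amplitude_pos k
        gcongr
        refine le_of_le_of_eq ?_ tsum_geometric_two
        exact summable_geometric_two.sum_le_tsum _ fun _ _ => by positivity
    _ = _ := by ring

/-- In exponents, `θ k⁴ ≥ 2 k³ ≥ k² + k`: any positive power of the wavelength is eventually far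
below the amplitude. -/
theorem wavelength_rpow_le {θ : ℝ} {k : ℕ} (hθ : 2 ≤ θ * k) :
    wavelength k ^ θ ≤ amplitude k * (1 / 2) ^ k := by
  unfold wavelength amplitude
  rw [← pow_add, ← Real.rpow_natCast, ← Real.rpow_mul (by norm_num), ← Real.rpow_natCast]
  refine Real.rpow_le_rpow_of_exponent_ge (by norm_num) (by norm_num) ?_
  push_cast
  have hk : (1 : ℝ) ≤ k := by
    rcases Nat.eq_zero_or_pos k with rfl | h
    · norm_num at hθ
    · exact_mod_cast h
  have h₃ : (k : ℝ) ^ 2 ≤ (k : ℝ) ^ 3 := pow_le_pow_right₀ hk (by norm_num)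
  have h₁ : (k : ℝ) ≤ (k : ℝ) ^ 2 := le_self_pow₀ hk (by norm_num)
  have : 2 * (k : ℝ) ^ 3 ≤ θ * k * (k : ℝ) ^ 3 := by gcongr
  linarith [this, show θ * k * (k : ℝ) ^ 3 = (k : ℝ) ^ 4 * θ by ring]

/-- If the terms of a series are controlled by the amplitudes and wavelengths, a single term
dominates all the others. -/
theorem le_neg_of_hasSum {G : ℕ → ℝ} {S d B : ℝ} {k : ℕ} (hS : HasSum G S)
    (h₁ : ∀ l, |G l| ≤ amplitude l * B)
    (h₂ : ∀ l, |G l| ≤ amplitude l / wavelength l * (20 * d * wavelength k))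
    (h₃ : amplitude k * (d / 4) ≤ -G k) (hd : 0 ≤ d) (hB : 0 ≤ B) :
    amplitude k * (d / 4 - (80 * d + B) * (1 / 2) ^ k) ≤ -S := by
  have hsplit := hS.summable.sum_add_tsum_nat_add (k + 1)
  rw [hS.tsum_eq, Finset.sum_range_succ] at hsplit
  have hsum : Summable fun m => amplitude (m + (k + 1)) * B :=
    ((summable_nat_add_iff (k + 1)).mpr summable_amplitude).mul_right B
  have htail : ∑' m, G (m + (k + 1)) ≤ amplitude k * (1 / 2) ^ k * B := by
    calc ∑' m, G (m + (k + 1)) ≤ ∑' m, amplitude (m + (k + 1)) * B :=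
          ((summable_nat_add_iff (k + 1)).mpr hS.summable).tsum_le_tsum
            (fun m => (le_abs_self _).trans (h₁ _)) hsum
      _ ≤ _ := by
          rw [tsum_mul_right]
          exact mul_le_mul_of_nonneg_right (tsum_amplitude_le k) hB
  have hhead : ∑ l ∈ Finset.range k, G l ≤ 20 * d * (4 * (amplitude k * (1 / 2) ^ k)) := by
    calc ∑ l ∈ Finset.range k, G l
        ≤ ∑ l ∈ Finset.range k, amplitude l / wavelength l * (20 * d * wavelength k) :=
          Finset.sum_le_sum fun l _ => (le_abs_self _).trans (h₂ l)
      _ = 20 * d * ((∑ l ∈ Finset.range k, amplitude l / wavelength l) * wavelength k) := by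
          rw [← Finset.sum_mul]
          ring
      _ ≤ _ := mul_le_mul_of_nonneg_left (sum_amplitude_div_wavelength_mul_le k) (by positivity)
  linarith

/-! ### Hölder's inequality and two auxiliary facts -/

theorem setIntegral_le_eLpNorm_mul_rpow {α : Type*} [MeasurableSpace α] {μ : Measure α}
    {w : α → ℝ} {q : ENNReal} (hq : 1 ≤ q) {R Ω : Set α} (hR : R ⊆ Ω) (hR' : μ R ≠ ⊤)
    (hw : ∀ x, 0 ≤ w x) (h : MemLp w q (μ.restrict Ω)) :
    ∫ x in R, w x ∂μ ≤
      (eLpNorm w q (μ.restrict Ω)).toReal * μ.real R ^ (1 - 1 / q.toReal) := by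
  have hR₀ := h.mono_measure (Measure.restrict_mono hR le_rfl)
  have hθ : 0 ≤ 1 - 1 / q.toReal := by
    -- For `q = ⊤` the conventions `⊤.toReal = 0` and `1 / 0 = 0` give the correct exponent `1`.
    rcases eq_or_ne q ⊤ with rfl | hq'
    · simp
    · have : 1 ≤ q.toReal := by simpa using ENNReal.toReal_mono hq' hq
      rw [sub_nonneg]
      exact div_le_one_of_le₀ this (by linarith)
  have key := eLpNorm_le_eLpNorm_mul_rpow_measure_univ hq hR₀.aestronglyMeasurable
  rw [Measure.restrict_apply_univ, ENNReal.toReal_one, one_div_one] at key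
  have e : ∫ x in R, w x ∂μ = (eLpNorm w 1 (μ.restrict R)).toReal := by
    rw [eLpNorm_one_eq_lintegral_enorm, ← integral_norm_eq_lintegral_enorm hR₀.1]
    simp only [Real.norm_of_nonneg (hw _)]
  rw [e]
  have hle : eLpNorm w 1 (μ.restrict R) ≤
      eLpNorm w q (μ.restrict Ω) * μ R ^ (1 - 1 / q.toReal) :=
    key.trans (mul_le_mul_left (eLpNorm_mono_measure _ (Measure.restrict_mono hR le_rfl)) _)
  have := ENNReal.toReal_mono
    (ENNReal.mul_ne_top h.2.ne (ENNReal.rpow_ne_top_of_nonneg hθ hR')) hle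
  rwa [ENNReal.toReal_mul, ← ENNReal.toReal_rpow] at this

theorem iterPartialDeriv_const_mul {n : ℕ} {f : EuclideanSpace ℝ (Fin n) → ℝ}
    (hf : ContDiff ℝ (⊤ : ℕ∞) f) (a : ℝ) (l : List (Fin n)) :
    iterPartialDeriv l (fun x => a * f x) = fun x => a * iterPartialDeriv l f x := by
  induction l with
  | nil => rfl
  | cons i l ih =>
    change partialDeriv i (iterPartialDeriv l _) = fun x => a * partialDeriv i _ x
    rw [ih]
    funext x
    simp only [partialDeriv]
    rw [fderiv_const_mul ((iterPartialDeriv_contDiff hf l).differentiable (by simp) x)]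
    rfl

/-- Project an enumeration of `α × ℕ`: the indices lying over `a` reach every second coordinate, so
there are infinitely many. -/
theorem exists_nat_seq_frequently_eq (α : Type*) [Countable α] [Nonempty α] :
    ∃ s : ℕ → α, ∀ a, ∃ᶠ k in Filter.atTop, s k = a := by
  obtain ⟨t, ht⟩ := exists_surjective_nat (α × ℕ)
  refine ⟨fun k => (t k).1, fun a => ?_⟩
  rw [Nat.frequently_atTop_iff_infinite]
  intro hfin
  refine Set.infinite_univ ((hfin.image fun k => (t k).2).subset fun m _ => ?_)
  obtain ⟨k, hk⟩ := ht (a, m)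
  exact ⟨k, by simp [hk], by simp [hk]⟩

/-! ### The series: Sobolev, subharmonic and Lipschitz properties -/

/-- The `k`-th term of the series, rippling in the direction `(s k).1` along the line on which the
other coordinate is `(s k).2`. -/
def rippleTerm (s : ℕ → Fin 2 × ℚ) (k : ℕ) (x : EuclideanSpace ℝ (Fin 2)) : ℝ :=
  amplitude k * ripple (s k).1 ((s k).1 + 1) (wavelength k) (s k).2 x

theorem Fin.ne_add_one_of_two (i : Fin 2) : i ≠ i + 1 := by omega

variable (s : ℕ → Fin 2 × ℚ)

theorem rippleTerm_contDiff (k : ℕ) : ContDiff ℝ (⊤ : ℕ∞) (rippleTerm s k) :=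
  contDiff_const.mul (ripple_contDiff _ _ _ _)

theorem iterPartialDeriv_rippleTerm (k : ℕ) (l : List (Fin 2)) :
    iterPartialDeriv l (rippleTerm s k) = fun x => amplitude k *
      iterPartialDeriv l (ripple (s k).1 ((s k).1 + 1) (wavelength k) (s k).2) x :=
  iterPartialDeriv_const_mul (ripple_contDiff _ _ _ _) _ _

theorem integrableOn_ball_of_contDiff {n : ℕ} {f : EuclideanSpace ℝ (Fin n) → ℝ}
    (hf : ContDiff ℝ (⊤ : ℕ∞) f) : IntegrableOn f (Metric.ball 0 1) :=
  (hf.continuous.continuousOn.integrableOn_compact (isCompact_closedBall 0 1)).mono_set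
    Metric.ball_subset_closedBall

theorem integrableOn_iterPartialDeriv_rippleTerm (k : ℕ) (l : List (Fin 2)) :
    IntegrableOn (iterPartialDeriv l (rippleTerm s k)) (Metric.ball 0 1) :=
  integrableOn_ball_of_contDiff (iterPartialDeriv_contDiff (rippleTerm_contDiff s k) l)

theorem integral_norm_iterPartialDeriv_rippleTerm_le (k : ℕ) {l : List (Fin 2)}
    (hl : l.length ≤ 2) :
    ∫ x in Metric.ball 0 1, ‖iterPartialDeriv l (rippleTerm s k) x‖ ≤ amplitude k *
      (12 * volume.real (Metric.ball (0 : EuclideanSpace ℝ (Fin 2)) 1) + 10 * Real.pi) := by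
  rw [iterPartialDeriv_rippleTerm]
  simp only [norm_mul, Real.norm_of_nonneg (amplitude_pos k).le]
  rw [integral_const_mul]
  exact mul_le_mul_of_nonneg_left (integral_norm_iterPartialDeriv_ripple_le_of_length_le
    (Fin.ne_add_one_of_two _) (wavelength_pos k) hl) (amplitude_pos k).le

theorem summable_integral_norm_iterPartialDeriv_rippleTerm {l : List (Fin 2)}
    (hl : l.length ≤ 2) :
    Summable fun k => ∫ x in Metric.ball 0 1, ‖iterPartialDeriv l (rippleTerm s k) x‖ :=
  Summable.of_nonneg_of_le (fun _ => integral_nonneg fun _ => norm_nonneg _)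
    (fun k => integral_norm_iterPartialDeriv_rippleTerm_le s k hl) (summable_amplitude.mul_right _)

theorem hasWeakDeriv_tsum_rippleTerm {l : List (Fin 2)} (hl : l.length ≤ 2) :
    HasWeakDeriv (Metric.ball 0 1) l (fun x => ∑' k, rippleTerm s k x)
      (fun x => ∑' k, iterPartialDeriv l.reverse (rippleTerm s k) x) :=
  hasWeakDeriv_tsum (rippleTerm_contDiff s)
    (fun k => integrableOn_iterPartialDeriv_rippleTerm s k [])
    (summable_integral_norm_iterPartialDeriv_rippleTerm s (l := []) (by simp))
    (fun k => integrableOn_iterPartialDeriv_rippleTerm s k _)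
    (summable_integral_norm_iterPartialDeriv_rippleTerm s (by simpa using hl))

theorem memSobolevSpace_tsum_rippleTerm :
    MemSobolevSpace 2 1 (Metric.ball 0 1) fun x => ∑' k, rippleTerm s k x := by
  have key : ∀ l : List (Fin 2), l.length ≤ 2 → MemLp
      (fun x => ∑' k, iterPartialDeriv l (rippleTerm s k) x) 1
      (volume.restrict (Metric.ball 0 1)) := fun l hl =>
    memLp_one_iff_integrable.mpr (integrable_tsum_of_summable_integral_norm
      (fun k => integrableOn_iterPartialDeriv_rippleTerm s k l)
      (summable_integral_norm_iterPartialDeriv_rippleTerm s hl))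
  exact ⟨key [] (by simp),
    fun l hl => ⟨_, hasWeakDeriv_tsum_rippleTerm s hl, key _ (by simpa using hl)⟩⟩

theorem isDistribSubharmonicOn_tsum_rippleTerm :
    IsDistribSubharmonicOn (Metric.ball 0 1) fun x => ∑' k, rippleTerm s k x := by
  refine isDistribSubharmonicOn_tsum (rippleTerm_contDiff s)
    (fun k => integrableOn_iterPartialDeriv_rippleTerm s k [])
    (summable_integral_norm_iterPartialDeriv_rippleTerm s (l := []) (by simp)) fun k x => ?_
  have e : rippleTerm s k =
      amplitude k • ripple (s k).1 ((s k).1 + 1) (wavelength k) (s k).2 := rfl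
  rw [e, InnerProductSpace.laplacian_smul _
    ((ripple_contDiff _ _ _ _).contDiffAt.of_le
      (WithTop.coe_le_coe.mpr (le_top : (2 : ℕ∞) ≤ ⊤))), smul_eq_mul]
  exact mul_nonneg (amplitude_pos k).le
    (laplacian_ripple_nonneg (Fin.ne_add_one_of_two _) (wavelength_pos k) x)

theorem lipschitzOnWith_tsum_rippleTerm :
    ∃ K : NNReal, LipschitzOnWith K (fun x => ∑' k, rippleTerm s k x) (Metric.ball 0 1) := by
  have hsum : ∀ x, Summable fun k => rippleTerm s k x := fun x => by
    refine Summable.of_norm_bounded (summable_amplitude.mul_right (12 * ‖x‖)) fun k => ?_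
    rw [rippleTerm, norm_mul, Real.norm_of_nonneg (amplitude_pos k).le]
    exact mul_le_mul_of_nonneg_left
      (abs_ripple_le (Fin.ne_add_one_of_two _) (wavelength_pos k).ne' x) (amplitude_pos k).le
  have h0 : 0 ≤ ∑' k, amplitude k * 12 :=
    tsum_nonneg fun k => mul_nonneg (amplitude_pos k).le (by norm_num)
  refine ⟨⟨_, h0⟩, (LipschitzWith.of_dist_le_mul fun x y => ?_).lipschitzOnWith⟩
  rw [dist_eq_norm, ← (hsum x).tsum_sub (hsum y)]
  change _ ≤ (∑' k, amplitude k * 12) * dist x y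
  rw [← tsum_mul_right]
  refine tsum_of_norm_bounded
    ((summable_amplitude.mul_right 12).mul_right (dist x y)).hasSum fun k => ?_
  simp only [rippleTerm]
  rw [← mul_sub, norm_mul, Real.norm_of_nonneg (amplitude_pos k).le, mul_assoc]
  exact mul_le_mul_of_nonneg_left ((lipschitzWith_ripple (c := (s k).2)
    (Fin.ne_add_one_of_two (s k).1) (wavelength_pos k).ne').dist_le_mul x y) (amplitude_pos k).le

/-! ### The negative part on strips and the contradiction -/

theorem strip_subset_ball {i j : Fin 2} (hij : i ≠ j) {x : EuclideanSpace ℝ (Fin 2)}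
    {d ε c r : ℝ} (hd : 0 ≤ d) (hε : 4 * d ≤ ε) (hc : |c - x j| < d) (hr : r ≤ d) :
    strip i j (x i) d c r ⊆ Metric.ball x ε := by
  rintro y ⟨⟨h₁, h₂⟩, h₃, h₄⟩
  rw [abs_lt] at hc
  rw [Metric.mem_ball, EuclideanSpace.dist_eq, Fin.univ_eq_pair hij,
    Finset.sum_pair hij, Real.sqrt_lt' (by linarith),
    Real.dist_eq, Real.dist_eq, sq_abs, sq_abs]
  have e₁ : (y i - x i) ^ 2 ≤ d ^ 2 := sq_le_sq' (by linarith) (by linarith)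
  have e₂ : (y j - x j) ^ 2 ≤ (2 * d) ^ 2 := sq_le_sq' (by linarith) (by linarith)
  have e₃ : (4 * d) ^ 2 ≤ ε ^ 2 := pow_le_pow_left₀ (by linarith) hε 2
  nlinarith

theorem le_setIntegral_strip_tsum {k : ℕ} {p d : ℝ} (hd : 5 * wavelength k ≤ d)
    (hR : strip (s k).1 ((s k).1 + 1) p d (s k).2 (wavelength k) ⊆ Metric.ball 0 1) :
    amplitude k * (d / 4 - (80 * d +
      (12 * volume.real (Metric.ball (0 : EuclideanSpace ℝ (Fin 2)) 1) + 10 * Real.pi)) *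
        (1 / 2) ^ k) ≤
      ∫ x in strip (s k).1 ((s k).1 + 1) p d (s k).2 (wavelength k),
        max (-∑' m, iterPartialDeriv [(s k).1, (s k).1] (rippleTerm s m) x) 0 := by
  set i := (s k).1
  set R := strip i (i + 1) p d (s k).2 (wavelength k)
  have hw := wavelength_pos k
  have hd0 : 0 ≤ d := by linarith
  set F : ℕ → EuclideanSpace ℝ (Fin 2) → ℝ := fun m => iterPartialDeriv [i, i] (rippleTerm s m)
  have hFB : ∀ m, IntegrableOn (F m) (Metric.ball 0 1) := fun m =>
    integrableOn_iterPartialDeriv_rippleTerm s m _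
  have hF : ∀ m, IntegrableOn (F m) R := fun m => (hFB m).mono_set hR
  have hle : ∀ m, ∫ x in R, ‖F m x‖ ≤ ∫ x in Metric.ball 0 1, ‖F m x‖ := fun m =>
    setIntegral_mono_set (hFB m).norm (.of_forall fun x => norm_nonneg _) hR.eventuallyLE
  have hs : Summable fun m => ∫ x in R, ‖F m x‖ :=
    Summable.of_nonneg_of_le (fun m => integral_nonneg fun x => norm_nonneg _) hle
      (summable_integral_norm_iterPartialDeriv_rippleTerm s (by simp))
  -- As `0 ≤ ψ ≤ 1`, the mass of the negative part is at least `-∫ ∂_ii u ψ`. This is linear in `u`,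
  -- so it can be summed termwise, and `ψ` is in phase with the `k`-th term.
  set ψ : EuclideanSpace ℝ (Fin 2) → ℝ := fun x => (1 + Real.cos (x i / wavelength k)) / 2
  have hψ : Continuous ψ := by fun_prop
  have hψ0 : ∀ x, 0 ≤ ψ x := fun x => by
    have := Real.neg_one_le_cos (x i / wavelength k)
    simp only [ψ]
    linarith
  have hψ1 : ∀ x, ‖ψ x‖ ≤ 1 := fun x => by
    rw [Real.norm_of_nonneg (hψ0 x)]
    have := Real.cos_le_one (x i / wavelength k)
    simp only [ψ]
    linarith
  have hint := integrable_tsum_of_summable_integral_norm hF hs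
  have hmul : ∀ m x, ‖F m x * ψ x‖ ≤ ‖F m x‖ := fun m x => by
    rw [norm_mul]
    exact mul_le_of_le_one_right (norm_nonneg _) (hψ1 x)
  have hvol : volume.real R = 4 * d * wavelength k :=
    volume_real_strip (Fin.ne_add_one_of_two i) hd0 hw.le
  have main := le_neg_of_hasSum
    (hasSum_integral_mul_of_bounded hF hs hψ.aestronglyMeasurable hψ1) (d := d) (k := k)
    (B := 12 * volume.real (Metric.ball (0 : EuclideanSpace ℝ (Fin 2)) 1) + 10 * Real.pi)
    ?_ ?_ ?_ hd0 (by positivity)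
  · refine main.trans ?_
    rw [← integral_neg]
    refine integral_mono ?_ ?_ fun x => ?_
    · exact (hint.mul_bdd hψ.aestronglyMeasurable (.of_forall hψ1)).neg
    · exact hint.neg.sup (integrable_zero _ _ _)
    · dsimp only
      rw [← neg_mul]
      have h₀ := hψ0 x
      have h₁ := (le_abs_self _).trans (hψ1 x)
      generalize -∑' m, F m x = z
      exact (mul_le_mul_of_nonneg_right (le_max_left z 0) h₀).trans
        (mul_le_of_le_one_right (le_max_right z 0) h₁)
  · intro m
    refine (norm_integral_le_integral_norm fun x => F m x * ψ x).trans ?_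
    refine (integral_mono ((hF m).mul_bdd hψ.aestronglyMeasurable (.of_forall hψ1)).norm
      (hF m).norm (hmul m)).trans ((hle m).trans ?_)
    exact integral_norm_iterPartialDeriv_rippleTerm_le s m (by simp)
  -- Supremum bound `5 a_m / r_m` times the area `4 d r_k` of the strip, whence the constant `20`.
  · intro m
    have hbound : ∀ x ∈ R, ‖F m x * ψ x‖ ≤ amplitude m * (5 / wavelength m) := fun x _ => by
      refine (hmul m x).trans ?_
      simp only [F]
      rw [iterPartialDeriv_rippleTerm, norm_mul, Real.norm_of_nonneg (amplitude_pos m).le]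
      refine mul_le_mul_of_nonneg_left ?_ (amplitude_pos m).le
      refine (abs_iterPartialDeriv_ripple_le (Fin.ne_add_one_of_two _) (wavelength_pos m) _ _
        x).trans (mul_le_of_le_one_right (div_nonneg (by norm_num) (wavelength_pos m).le) ?_)
      exact inv_le_one_of_one_le₀ (le_add_of_nonneg_right (sq_nonneg _))
    have := norm_setIntegral_le_of_norm_le_const (f := fun x => F m x * ψ x) (μ := volume)
      ((measure_mono hR).trans_lt measure_ball_lt_top) hbound
    refine this.trans (le_of_eq ?_)
    rw [hvol]
    ring
  · rw [← integral_neg]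
    have e : ∀ x, -(F k x * ψ x) = amplitude k * (-iterPartialDeriv [i, i]
        (ripple i (i + 1) (wavelength k) (s k).2) x * ψ x) := fun x => by
      simp only [F]
      rw [iterPartialDeriv_rippleTerm]
      ring
    simp only [e]
    rw [integral_const_mul]
    exact mul_le_mul_of_nonneg_left
      (le_setIntegral_strip_ripple (Fin.ne_add_one_of_two i) hw hd) (amplitude_pos k).le

theorem tendsto_wavelength : Filter.Tendsto wavelength Filter.atTop (nhds 0) :=
  (tendsto_pow_atTop_nhds_zero_of_lt_one (by norm_num) (by norm_num)).comp
    (Filter.tendsto_pow_atTop (by norm_num))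

theorem not_memLp_negPart_tsum_rippleTerm {s : ℕ → Fin 2 × ℚ}
    (hs : ∀ a, ∃ᶠ k in Filter.atTop, s k = a) (i : Fin 2) {q : ENNReal} (hq : 1 < q)
    {Ω : Set (EuclideanSpace ℝ (Fin 2))} (hΩ : IsOpen Ω) (hne : Ω.Nonempty)
    (hsub : Ω ⊆ Metric.ball 0 1) :
    ¬ MemLp (fun x => max (-∑' m, iterPartialDeriv [i, i] (rippleTerm s m) x) 0) q
      (volume.restrict Ω) := by
  intro hmem
  obtain ⟨x, hx⟩ := hne
  obtain ⟨ε, hε, hball⟩ := Metric.isOpen_iff.mp hΩ x hx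
  set d := ε / 4 with hd
  have hd0 : 0 < d := by positivity
  obtain ⟨c, hc₁, hc₂⟩ := exists_rat_btwn (show x (i + 1) - d < x (i + 1) + d by linarith)
  set θ : ℝ := 1 - 1 / q.toReal with hθ
  have hθ0 : 0 < θ := by
    rcases eq_or_ne q ⊤ with rfl | hq'
    · simp [hθ]
    · have : 1 < q.toReal := by simpa using (ENNReal.toReal_lt_toReal (by simp) hq').mpr hq
      rw [hθ, sub_pos]
      exact (div_lt_one (by linarith)).mpr this
  set N := (eLpNorm (fun x => max (-∑' m, iterPartialDeriv [i, i] (rippleTerm s m) x) 0) q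
    (volume.restrict Ω)).toReal
  set B := 12 * volume.real (Metric.ball (0 : EuclideanSpace ℝ (Fin 2)) 1) + 10 * Real.pi
  set C := 80 * d + B + N * (4 * d) ^ θ
  have ev₁ : ∀ᶠ k in Filter.atTop, 5 * wavelength k < d :=
    (by simpa using tendsto_wavelength.const_mul 5 :
      Filter.Tendsto (fun k => 5 * wavelength k) Filter.atTop (nhds 0)).eventually_lt_const hd0
  have ev₂ : ∀ᶠ k : ℕ in Filter.atTop, 2 ≤ θ * k :=
    (tendsto_natCast_atTop_atTop.const_mul_atTop hθ0).eventually_ge_atTop 2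
  have ev₃ : ∀ᶠ k : ℕ in Filter.atTop, C * (1 / 2 : ℝ) ^ k < d / 4 := by
    have : Filter.Tendsto (fun k : ℕ => C * (1 / 2 : ℝ) ^ k) Filter.atTop (nhds 0) := by
      simpa using (tendsto_pow_atTop_nhds_zero_of_lt_one (r := (1 / 2 : ℝ)) (by norm_num)
        (by norm_num)).const_mul C
    exact this.eventually_lt_const (by positivity)
  -- The pair `(i, c)` recurs at arbitrarily large `k`. After division by the amplitude, the lower
  -- bound and Hölder combine to `d / 4 ≤ C 2^(-k)`, which `ev₃` excludes.
  obtain ⟨k, hk, h₁, h₂, h₃⟩ := ((hs (i, c)).and_eventually (ev₁.and (ev₂.and ev₃))).exists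
  have hw := wavelength_pos k
  have hR : strip i (i + 1) (x i) d c (wavelength k) ⊆ Ω :=
    (strip_subset_ball (Fin.ne_add_one_of_two i) hd0.le (by linarith)
      (abs_lt.mpr ⟨by linarith, by linarith⟩) (by linarith)).trans hball
  have lower := le_setIntegral_strip_tsum s (k := k) (p := x i) h₁.le
    (by simpa only [hk] using hR.trans hsub)
  simp only [hk] at lower
  have upper := setIntegral_le_eLpNorm_mul_rpow hq.le hR
    ((measure_mono (hR.trans hsub)).trans_lt measure_ball_lt_top).ne
    (fun x => le_max_right _ _) hmem
  rw [volume_real_strip (Fin.ne_add_one_of_two i) hd0.le hw.le,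
    Real.mul_rpow (by positivity) hw.le] at upper
  have hN : N * ((4 * d) ^ θ * wavelength k ^ θ) ≤
      amplitude k * (N * (4 * d) ^ θ * (1 / 2) ^ k) := by
    rw [show amplitude k * (N * (4 * d) ^ θ * (1 / 2) ^ k) =
      N * ((4 * d) ^ θ * (amplitude k * (1 / 2) ^ k)) by ring]
    have : 0 ≤ N := ENNReal.toReal_nonneg
    gcongr
    exact wavelength_rpow_le h₂
  have h₄ := le_of_mul_le_mul_left ((lower.trans upper).trans hN) (amplitude_pos k)
  have e : C * (1 / 2 : ℝ) ^ k = (80 * d + B) * (1 / 2) ^ k + N * (4 * d) ^ θ * (1 / 2) ^ k := by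
    ring
  linarith

end

theorem theorem3p2 :
    ∃ u : EuclideanSpace ℝ (Fin 2) → ℝ,
      (∃ K : NNReal, LipschitzOnWith K u (Metric.ball 0 1)) ∧
      IsDistribSubharmonicOn (Metric.ball 0 1) u ∧
      MemSobolevSpace 2 1 (Metric.ball 0 1) u ∧
      ∀ (i : Fin 2) (h : EuclideanSpace ℝ (Fin 2) → ℝ),
        HasWeakDeriv (Metric.ball 0 1) [i, i] u h →
        ∀ q : ENNReal, 1 < q →
        ∀ Ω' : Set (EuclideanSpace ℝ (Fin 2)), IsOpen Ω' → Ω'.Nonempty →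
          Ω' ⊆ Metric.ball 0 1 →
          ¬ MemLp (fun x => max (-h x) 0) q (volume.restrict Ω') := by
  obtain ⟨s, hs⟩ := exists_nat_seq_frequently_eq (Fin 2 × ℚ)
  refine ⟨_, lipschitzOnWith_tsum_rippleTerm s, isDistribSubharmonicOn_tsum_rippleTerm s,
    memSobolevSpace_tsum_rippleTerm s, fun i h hh q hq Ω hΩ hne hsub hmem => ?_⟩
  refine not_memLp_negPart_tsum_rippleTerm hs i hq hΩ hne hsub (hmem.ae_eq ?_)
  have := hh.ae_eq Metric.isOpen_ball
    (hasWeakDeriv_tsum_rippleTerm s (l := [i, i]) (by simp))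
  filter_upwards [ae_restrict_of_ae_restrict_of_subset hsub this] with x hx
  rw [hx]
  rfl
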